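/- For $d\ge 1$ let $\Delta_d=\{0,e_1,\dots,e_d\}\subset\mathbb Z^d$ be the vertex set of the standard simplex. A relaxation of $X\subseteq\mathbb Z^d$ is a polyhedron $Q\subseteq\mathbb R^d$ (the solution set of finitely many linear inequalities) with $Q\cap\mathbb Z^d=X$; the relaxation complexity $\operatorname{rc}(X)\in\mathbb N\cup\{\infty\}$ is the least number of facets of a relaxation of $X$, and the rational relaxation complexity $\operatorname{rc}_{\mathbb Q}(X)$ is the least number of facets of a relaxation of $X$ that is a rational polyhedron (described by finitely many inequalities with rational coefficients and right-hand sides). Theorem. $\operatorname{rc}(\Delta_5)=5$, whereas $\operatorname{rc}_{\mathbb Q}(\Delta_5)=6$. Moreover, a relaxation with five facets is given explicitly as follows. Let $\Delta=\{0,e_1,e_2,e_3,(1,0,1,1,0),(0,1,1,0,1)\}\subset\mathbb Z^5$, let $\ell\subset\mathbb R^5$ be the line spanned by $(0,0,0,1,\sqrt2)$, let $\pi(x_1,\dots,x_5)=(x_1,x_2,x_3,x_4-\tfrac1{\sqrt2}x_5)$, and let $P_{1/8}\subset\mathbb R^4$ be the polyhedron defined, with $\varepsilon=\tfrac18$, by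 the five inequalities \[ x_1\ge x_4,\quad x_3\ge x_4,\quad \varepsilon x_1+x_2+\tfrac{1-\varepsilon}{1+\sqrt2}x_3+\tfrac{(1-\varepsilon)\sqrt2}{1+\sqrt2}x_4\le 1,\quad x_3+\sqrt2\,x_4\ge 0,\quad x_1-(1+\varepsilon)x_2+x_3-x_4\le 1. \] Then $\Delta$ is the image of $\Delta_5$ under an affine map of $\mathbb R^5$ that maps $\mathbb Z^5$ onto itself; $P_{1/8}$ is described by five inequalities with coefficients in $\mathbb Q(\sqrt2)$ and $P_{1/8}\cap(\mathbb Z^3\times\mathbb R)=\pi(\Delta)$; and the set $Q=(P_{1/8}\times\{0\})+\ell$ equals $\pi^{-1}(P_{1/8})$, is a polyhedron described by five inequalities with coefficients in $\mathbb Q(\sqrt2)$, is not a rational polyhedron, has exactly five facets, and satisfies $Q\cap\mathbb Z^5=\Delta$. -/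

import Mathlib

open scoped Pointwise

namespace RelaxationComplexity

/-- `P ⊆ ℝ^d` is the solution set of a system `A x ≤ b` of `m` linear inequalities all of whose
coefficients and right-hand sides lie in the field `K` (with its given embedding into `ℝ`). -/
def IsPolyhedronOver (K : Type) [Field K] [Algebra K ℝ] (m : ℕ) {d : ℕ}
    (P : Set (Fin d → ℝ)) : Prop :=
  ∃ (A : Matrix (Fin m) (Fin d) K) (b : Fin m → K),
    P = {x | ∀ i, ∑ j, algebraMap K ℝ (A i j) * x j ≤ algebraMap K ℝ (b i)}

/-- A polyhedron in `ℝ^d`: the solution set of finitely many linear inequalities. -/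
def IsPolyhedron {d : ℕ} (P : Set (Fin d → ℝ)) : Prop :=
  ∃ m, IsPolyhedronOver ℝ m P

/-- A rational polyhedron in `ℝ^d`: the solution set of finitely many rational linear
inequalities. -/
def IsRationalPolyhedron {d : ℕ} (P : Set (Fin d → ℝ)) : Prop :=
  ∃ m, IsPolyhedronOver ℚ m P

/-- The dimension of (the affine hull of) a nonempty subset of `ℝ^d`. -/
noncomputable def dim {d : ℕ} (S : Set (Fin d → ℝ)) : ℕ :=
  Module.finrank ℝ (vectorSpan ℝ S)

/-- The facets of a polyhedron `P`: the nonempty faces of `P` of dimension `dim P - 1`, where a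
nonempty face is the set of maximizers over `P` of some linear functional. -/
def facets {d : ℕ} (P : Set (Fin d → ℝ)) : Set (Set (Fin d → ℝ)) :=
  {F | IsExposed ℝ P F ∧ F.Nonempty ∧ dim F + 1 = dim P}

/-- `P` is a (polyhedral) relaxation of `X` within `Y`. -/
def IsRelaxation {d : ℕ} (P X Y : Set (Fin d → ℝ)) : Prop :=
  IsPolyhedron P ∧ P ∩ Y = X

/-- The integer points of `ℝ^d`. -/
def integerPoints (d : ℕ) : Set (Fin d → ℝ) :=
  {x | ∀ i, ∃ z : ℤ, x i = z}

/-- The relaxation complexity of `X` within `Y`: the least number of facets of a relaxation of `X`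
within `Y`, and `⊤` if there is no relaxation. -/
noncomputable def rcWithin {d : ℕ} (X Y : Set (Fin d → ℝ)) : ℕ∞ :=
  ⨅ (P : Set (Fin d → ℝ)) (_ : IsRelaxation P X Y), (facets P).encard

/-- The (integer) relaxation complexity of a set `X` of integer points of `ℝ^d`. -/
noncomputable def rc {d : ℕ} (X : Set (Fin d → ℝ)) : ℕ∞ :=
  rcWithin X (integerPoints d)

/-- The rational relaxation complexity of a set `X` of integer points of `ℝ^d`: only relaxations
that are rational polyhedra are allowed. -/
noncomputable def rcRat {d : ℕ} (X : Set (Fin d → ℝ)) : ℕ∞ :=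
  ⨅ (P : Set (Fin d → ℝ)) (_ : IsRelaxation P X (integerPoints d))
    (_ : IsRationalPolyhedron P), (facets P).encard

/-- `Δ_d`: the vertex set `{0, e_1, …, e_d}` of the standard simplex in `ℝ^d`. -/
def simplexVertices (d : ℕ) : Set (Fin d → ℝ) :=
  insert 0 (Set.range fun i : Fin d => (Pi.single i 1 : Fin d → ℝ))

/-- Two subsets of `ℝ^d` are unimodularly equivalent if an affine map of `ℝ^d` that maps `ℤ^d`
onto itself maps the first one onto the second one. -/
def UnimodularlyEquivalent {d : ℕ} (X Y : Set (Fin d → ℝ)) : Prop :=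
  ∃ φ : (Fin d → ℝ) →ᵃ[ℝ] (Fin d → ℝ), φ '' integerPoints d = integerPoints d ∧ φ '' X = Y

/-- The set `Δ = {0, e_1, e_2, e_3, (1,0,1,1,0), (0,1,1,0,1)} ⊆ ℤ^5`. -/
def simplexDelta : Set (Fin 5 → ℝ) :=
  {0, ![1, 0, 0, 0, 0], ![0, 1, 0, 0, 0], ![0, 0, 1, 0, 0], ![1, 0, 1, 1, 0], ![0, 1, 1, 0, 1]}

/-- The polyhedron `P_ε ⊆ ℝ^4`; the coordinates `x_1, …, x_4` are `x 0, …, x 3`. -/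
def polyhedronP (ε : ℝ) : Set (Fin 4 → ℝ) :=
  {x | x 0 ≥ x 3 ∧
    x 2 ≥ x 3 ∧
    ε * x 0 + x 1 + (1 - ε) / (1 + √2) * x 2 + (1 - ε) * √2 / (1 + √2) * x 3 ≤ 1 ∧
    x 2 + √2 * x 3 ≥ 0 ∧
    x 0 - (1 + ε) * x 1 + x 2 - x 3 ≤ 1}

/-- The line `ℓ ⊆ ℝ^5` spanned by `(0,0,0,1,√2)`. -/
noncomputable def lineEll : Submodule ℝ (Fin 5 → ℝ) :=
  Submodule.span ℝ {![0, 0, 0, 1, √2]}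

/-- The projection `ℝ^5 → ℝ^4` along the line `ℓ`. -/
noncomputable def projPi (x : Fin 5 → ℝ) : Fin 4 → ℝ :=
  ![x 0, x 1, x 2, x 3 - 1 / √2 * x 4]

/-- The mixed-integer points `ℤ^3 × ℝ ⊆ ℝ^4`. -/
def mixedIntegerPoints : Set (Fin 4 → ℝ) :=
  {x | ∀ i : Fin 3, ∃ z : ℤ, x i.castSucc = z}

/-- The set `(P × {0}) + ℓ ⊆ ℝ^5` for `P ⊆ ℝ^4`. -/
noncomputable def pullback (P : Set (Fin 4 → ℝ)) : Set (Fin 5 → ℝ) :=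
  (fun p : Fin 4 → ℝ => ![p 0, p 1, p 2, p 3, 0]) '' P + (lineEll : Set (Fin 5 → ℝ))

end RelaxationComplexity

open RelaxationComplexity

/-!
Lower bounds. A full-dimensional polyhedron given by inequalities over a field `K` is described by
as many of them as it has facets (`IsPolyhedronOver.exists_le_encard_facets`), because every
inequality of an irredundant system defines a facet. Hence it suffices to show that no four
inequalities, and no five rational ones, cut out six affinely independent integer points `p u` from
`ℤ^5`.

For five rational inequalities `A x ≤ b` the system `A v ≤ 0` has a nonzero rational solution, a
kernel vector or a solution of `A v = -1`; an integer multiple of it translates `p 0` to infinitely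
many integer points of the polyhedron (`not_isPolyhedronOver_rat_five`).

For four real inequalities there is a kernel vector, and by Dirichlet approximation a large integer
vector `z` on which all four functionals are tiny (`exists_large_int_small`). The points `p u + z`
and `p u - z` have to be cut off, which only inequalities tight at `p u` can do. Thus every `p u` is
tight for an inequality that is positive at `z` and for one that is negative at `z`, and by affine
independence there are exactly two inequalities of either kind. Comparing slacks, and using that the
integer points `p u + p v - p w` with `w ≠ u, v` are infeasible, one sees that this is possible for
at most five points (`IsHiding.false_of_six`).

Upper bounds. A full-dimensional polyhedron has at most as many facets as inequalities
(`IsPolyhedronOver.encard_facets_le`), since the convex set underlying a facet lies in one of the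
bounding hyperplanes. The rational bound comes from the simplex itself. For the other one, the
mixed-integer points of `polyhedronP (1 / 8)` are found by a finite case analysis (`mixed_cases`).
The projection along the line is injective on `ℤ^5` since `√2` is irrational, so the preimage is a
relaxation of `simplexDelta`, and a unimodular map carries it to one of the simplex. As it has only
five facets, it cannot be rational.
-/

namespace RelaxationComplexity

/-! ### Facets and systems of linear inequalities -/

theorem dim_eq_of_vectorSpan_eq_top {d : ℕ} {P : Set (Fin d → ℝ)} (h : vectorSpan ℝ P = ⊤) :
    dim P = d := by
  rw [dim, h, finrank_top, Module.finrank_fin_fun]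

theorem vectorSpan_le_ker {d : ℕ} {S : Set (Fin d → ℝ)} {l : (Fin d → ℝ) →ₗ[ℝ] ℝ} {c : ℝ}
    (h : ∀ x ∈ S, l x = c) : vectorSpan ℝ S ≤ LinearMap.ker l := by
  refine Submodule.span_le.2 ?_
  rintro _ ⟨x, hx, y, hy, rfl⟩
  simp [h x hx, h y hy]

theorem eq_zero_of_const_on_spanning {d : ℕ} {S : Set (Fin d → ℝ)} (hS : vectorSpan ℝ S = ⊤)
    {l : (Fin d → ℝ) →ₗ[ℝ] ℝ} {c : ℝ} (h : ∀ x ∈ S, l x = c) : l = 0 := by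
  have := vectorSpan_le_ker h
  rw [hS, top_le_iff] at this
  exact LinearMap.ker_eq_top.1 this

/-- If every inequality of a finite system that is valid on a convex set is strict somewhere on
the set, then some point of the set (an average) satisfies all of them strictly. -/
theorem exists_forall_strict {d m : ℕ} {S : Set (Fin d → ℝ)} (hS : Convex ℝ S) (hne : S.Nonempty)
    {l : Fin m → (Fin d → ℝ) →ₗ[ℝ] ℝ} {β : Fin m → ℝ} (hle : ∀ x ∈ S, ∀ i, l i x ≤ β i)
    (p : Fin m → Prop) (h : ∀ i, p i → ∃ x ∈ S, l i x < β i) :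
    ∃ x ∈ S, ∀ i, p i → l i x < β i := by
  classical
  suffices H : ∀ T : Finset (Fin m), (∀ i ∈ T, p i) → ∃ x ∈ S, ∀ i ∈ T, l i x < β i by
    obtain ⟨x, hx, hx'⟩ := H (Finset.univ.filter p) (by simp)
    exact ⟨x, hx, fun i hi => hx' i (by simpa using hi)⟩
  intro T
  induction T using Finset.induction_on with
  | empty => exact fun _ => ⟨hne.some, hne.some_mem, by simp⟩
  | insert a T _ ih =>
    intro hT
    obtain ⟨x, hx, hxT⟩ := ih fun i hi => hT i (Finset.mem_insert_of_mem hi)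
    obtain ⟨y, hy, hya⟩ := h a (hT a (Finset.mem_insert_self _ _))
    refine ⟨(1 / 2 : ℝ) • x + (1 / 2 : ℝ) • y,
      hS hx hy (by norm_num) (by norm_num) (by norm_num), fun i hi => ?_⟩
    simp only [map_add, map_smul, smul_eq_mul]
    rcases Finset.mem_insert.1 hi with rfl | hi
    · linarith [hle x hx i]
    · linarith [hxT i hi, hle y hy i]

/-- A point satisfying finitely many linear inequalities strictly may be moved a little. -/
theorem exists_pos_forall_le {d m : ℕ} {l : Fin m → (Fin d → ℝ) →ₗ[ℝ] ℝ} {β : Fin m → ℝ}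
    (x v : Fin d → ℝ) (h : ∀ i, l i x < β i ∨ l i x ≤ β i ∧ l i v = 0) :
    ∃ t : ℝ, 0 < t ∧ ∀ i, l i (x + t • v) ≤ β i := by
  have key : ∀ᶠ t : ℝ in nhdsWithin 0 (Set.Ioi 0), ∀ i, l i (x + t • v) ≤ β i := by
    refine Filter.eventually_all.2 fun i => ?_
    rcases h i with hi | ⟨hi, hv⟩
    · have hc : Continuous fun t : ℝ => l i (x + t • v) := by
        simp only [map_add, map_smul, smul_eq_mul]
        fun_prop
      have := hc.continuousAt (x := 0) |>.eventually_lt continuousAt_const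
        (by simpa using hi : l i (x + (0 : ℝ) • v) < β i)
      exact (this.filter_mono nhdsWithin_le_nhds).mono fun t ht => ht.le
    · exact Filter.Eventually.of_forall fun t => by simpa [hv] using hi
  obtain ⟨t, ht, h0⟩ := (key.and self_mem_nhdsWithin).exists
  exact ⟨t, h0, ht⟩

theorem convex_of_inequalities {d m : ℕ} (l : Fin m → (Fin d → ℝ) →ₗ[ℝ] ℝ) (β : Fin m → ℝ) :
    Convex ℝ {x | ∀ i, l i x ≤ β i} := by
  rw [Set.ofPred_forall]
  exact convex_iInter fun i => convex_halfSpace_le (l i).isLinear (β i)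

/-- Every facet of a full-dimensional polyhedron `P` is cut out of `P` by turning one of the
inequalities of a given system for `P` into an equation. -/
theorem exists_eq_of_mem_facets {d m : ℕ} {l : Fin m → (Fin d → ℝ) →ₗ[ℝ] ℝ} {β : Fin m → ℝ}
    {P F : Set (Fin d → ℝ)} (hP : P = {x | ∀ i, l i x ≤ β i}) (hfull : vectorSpan ℝ P = ⊤)
    (hF : F ∈ facets P) : ∃ i, F = {x ∈ P | l i x = β i} := by
  obtain ⟨hexp, hne, hdim⟩ := hF
  have hconv : Convex ℝ P := hP ▸ convex_of_inequalities l β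
  have hFconv : Convex ℝ F := hexp.convex hconv
  obtain ⟨g, hg⟩ := hexp hne
  have hFP : F ⊆ P := hexp.subset
  rw [dim_eq_of_vectorSpan_eq_top hfull] at hdim
  have hg0 : g ≠ 0 := by
    rintro rfl
    have : F = P := by rw [hg]; ext; simp
    rw [this, dim_eq_of_vectorSpan_eq_top hfull] at hdim
    omega
  have hle : ∀ x ∈ F, ∀ i, l i x ≤ β i := fun x hx => by
    have := hFP hx
    rwa [hP] at this
  -- a point of `F` satisfying all the nontrivial inequalities strictly would be interior to `P`
  obtain ⟨i, hi0, hi⟩ : ∃ i, l i ≠ 0 ∧ ∀ x ∈ F, l i x = β i := by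
    by_contra! hcon
    obtain ⟨x, hx, hxs⟩ := exists_forall_strict hFconv hne hle (fun i => l i ≠ 0)
      fun i hi => by
        obtain ⟨x, hx, hne⟩ := hcon i hi
        exact ⟨x, hx, lt_of_le_of_ne (hle x hx i) hne⟩
    obtain ⟨v, hv⟩ : ∃ v, 0 < g v := by
      obtain ⟨v, hv⟩ : ∃ v, g v ≠ 0 := by
        by_contra! h
        exact hg0 (ContinuousLinearMap.ext h)
      rcases lt_or_gt_of_ne hv with h | h
      · exact ⟨-v, by simpa using h⟩
      · exact ⟨v, h⟩
    obtain ⟨t, ht, hxt⟩ := exists_pos_forall_le (l := l) (β := β) x v fun i => by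
      by_cases h : l i = 0
      · exact Or.inr ⟨hle x hx i, by simp [h]⟩
      · exact Or.inl (hxs i h)
    have hmem : x + t • v ∈ P := by rw [hP]; exact hxt
    rw [hg] at hx
    have := hx.2 _ hmem
    simp only [map_add, map_smul, smul_eq_mul] at this
    nlinarith
  refine ⟨i, Set.Subset.antisymm (fun x hx => ⟨hFP hx, hi x hx⟩) ?_⟩
  have hker : vectorSpan ℝ F = LinearMap.ker (l i) := by
    refine Submodule.eq_of_le_of_finrank_eq (vectorSpan_le_ker hi) ?_
    have := Module.Dual.finrank_ker_add_one_of_ne_zero hi0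
    rw [Module.finrank_fin_fun] at this
    unfold dim at hdim
    omega
  obtain ⟨y, hy⟩ := hne
  have hgF : ∀ x ∈ F, g.toLinearMap x = g y := fun x hx => by
    rw [hg] at hx hy
    exact le_antisymm (hy.2 x hx.1) (hx.2 y hy.1)
  have hgker := vectorSpan_le_ker hgF
  rintro x ⟨hxP, hxi⟩
  have hxy : x - y ∈ vectorSpan ℝ F := by
    rw [hker, LinearMap.mem_ker, map_sub, hxi, hi y hy, sub_self]
  have hgx : g x = g y := by
    have := hgker hxy
    rw [LinearMap.mem_ker, map_sub, sub_eq_zero] at this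
    exact this
  rw [hg] at hy ⊢
  exact ⟨hxP, fun z hz => by rw [hgx]; exact hy.2 z hz⟩

theorem encard_facets_le_of_inequalities {d m : ℕ} {l : Fin m → (Fin d → ℝ) →ₗ[ℝ] ℝ}
    {β : Fin m → ℝ} {P : Set (Fin d → ℝ)} (hP : P = {x | ∀ i, l i x ≤ β i})
    (hfull : vectorSpan ℝ P = ⊤) : (facets P).encard ≤ m := by
  have hsub : facets P ⊆ Set.range fun i => {x ∈ P | l i x = β i} := fun F hF => by
    obtain ⟨i, hi⟩ := exists_eq_of_mem_facets hP hfull hF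
    exact ⟨i, hi.symm⟩
  refine (Set.encard_le_encard hsub).trans ?_
  rw [← Set.image_univ]
  refine (Set.encard_image_le _ _).trans ?_
  simp

/-- In an irredundant system for a full-dimensional polyhedron, different inequalities define
different facets. -/
theorem le_encard_facets_of_irredundant {d m : ℕ} {l : Fin m → (Fin d → ℝ) →ₗ[ℝ] ℝ}
    {β : Fin m → ℝ} {P : Set (Fin d → ℝ)} (hP : P = {x | ∀ i, l i x ≤ β i}) (hne : P.Nonempty)
    (hfull : vectorSpan ℝ P = ⊤)
    (hirr : ∀ i, ∃ x, (∀ j, j ≠ i → l j x ≤ β j) ∧ β i < l i x) :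
    (m : ℕ∞) ≤ (facets P).encard := by
  have hmem : ∀ x, x ∈ P ↔ ∀ i, l i x ≤ β i := fun x => by rw [hP]; rfl
  have hl0 : ∀ i, l i ≠ 0 := fun i h0 => by
    obtain ⟨x, -, hx⟩ := hirr i
    obtain ⟨y, hy⟩ := hne
    have := (hmem y).1 hy i
    simp only [h0, LinearMap.zero_apply] at hx this
    linarith
  obtain ⟨x₀, -, hx₀⟩ := exists_forall_strict (hP ▸ convex_of_inequalities l β) hne
    (fun x hx => (hmem x).1 hx) (fun _ => True) fun i _ => by
      by_contra! h
      exact hl0 i (eq_zero_of_const_on_spanning hfull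
        fun x hx => le_antisymm ((hmem x).1 hx i) (h x hx))
  -- the segment from `x₀` to a point violating only the `i`-th inequality crosses the facet
  have hpt : ∀ i, ∃ q, l i q = β i ∧ ∀ j, j ≠ i → l j q < β j := fun i => by
    obtain ⟨x, hx, hxi⟩ := hirr i
    have h0 := hx₀ i trivial
    set t := (β i - l i x₀) / (l i x - l i x₀) with ht
    have hpos : 0 < l i x - l i x₀ := by linarith
    have ht0 : 0 < t := div_pos (by linarith) hpos
    have ht1 : t < 1 := (div_lt_one hpos).2 (by linarith)
    refine ⟨(1 - t) • x₀ + t • x, ?_, fun j hj => ?_⟩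
    · simp only [map_add, map_smul, smul_eq_mul]
      have : t * (l i x - l i x₀) = β i - l i x₀ := div_mul_cancel₀ _ hpos.ne'
      linarith
    · simp only [map_add, map_smul, smul_eq_mul]
      have h1 := hx₀ j trivial
      have h2 := hx j hj
      nlinarith
  choose q hq hq' using hpt
  have hqP : ∀ i, q i ∈ P := fun i => (hmem _).2 fun j => by
    by_cases h : j = i
    · rw [h, hq]
    · exact (hq' i j h).le
  set F : Fin m → Set (Fin d → ℝ) := fun i => {x ∈ P | l i x = β i} with hF
  have hinj : Function.Injective F := fun i j hij => by
    by_contra hne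
    have : q i ∈ F j := hij ▸ (⟨hqP i, hq i⟩ : q i ∈ F i)
    exact (hq' i j (Ne.symm hne)).ne this.2
  have hfac : ∀ i, F i ∈ facets P := fun i => by
    refine ⟨fun _ => ⟨(l i).toContinuousLinearMap, ?_⟩, ⟨q i, hqP i, hq i⟩, ?_⟩
    · ext x
      refine and_congr_right fun hx => ⟨fun h y hy => ?_, fun h => ?_⟩
      · simpa [h] using (hmem y).1 hy i
      · refine le_antisymm ((hmem x).1 hx i) ?_
        have := h (q i) (hqP i)
        simpa [hq] using this
    · have hker : vectorSpan ℝ (F i) = LinearMap.ker (l i) := by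
        refine le_antisymm (vectorSpan_le_ker fun x hx => hx.2) fun v hv => ?_
        rw [LinearMap.mem_ker] at hv
        obtain ⟨t, ht, h⟩ := exists_pos_forall_le (l := l) (β := β) (q i) v fun j => by
          by_cases h : j = i
          · exact Or.inr ⟨(hmem _).1 (hqP i) j, by rw [h, hv]⟩
          · exact Or.inl (hq' i j h)
        have h1 : q i + t • v ∈ F i := ⟨(hmem _).2 h, by simp [hv, hq]⟩
        have h2 := vsub_mem_vectorSpan ℝ h1 (⟨hqP i, hq i⟩ : q i ∈ F i)
        rw [vsub_eq_sub, add_sub_cancel_left] at h2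
        exact (Submodule.smul_mem_iff _ ht.ne').1 h2
      have := Module.Dual.finrank_ker_add_one_of_ne_zero (hl0 i)
      rw [Module.finrank_fin_fun] at this
      rw [dim_eq_of_vectorSpan_eq_top hfull, dim, hker, this]
  calc (m : ℕ∞) = (Set.range F).encard := by
        rw [← Set.image_univ, hinj.encard_image]; simp
    _ ≤ (facets P).encard := Set.encard_le_encard (by rintro _ ⟨i, rfl⟩; exact hfac i)

/-! ### Coefficient fields -/

/-- The linear functional on `ℝ^d` with coefficient vector `a`. -/
noncomputable def rowFunctional {d : ℕ} (a : Fin d → ℝ) : (Fin d → ℝ) →ₗ[ℝ] ℝ :=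
  ∑ j, a j • LinearMap.proj j

@[simp]
theorem rowFunctional_apply {d : ℕ} (a x : Fin d → ℝ) :
    rowFunctional a x = ∑ j, a j * x j := by
  simp [rowFunctional]

theorem IsPolyhedronOver.real {K : Type} [Field K] [Algebra K ℝ] {m d : ℕ}
    {P : Set (Fin d → ℝ)} (h : IsPolyhedronOver K m P) : IsPolyhedronOver ℝ m P := by
  obtain ⟨A, b, rfl⟩ := h
  exact ⟨A.map (algebraMap K ℝ), fun i => algebraMap K ℝ (b i), by simp⟩

theorem IsPolyhedronOver.mono {K : Type} [Field K] [Algebra K ℝ] {m n d : ℕ}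
    {P : Set (Fin d → ℝ)} (h : IsPolyhedronOver K m P) (hmn : m ≤ n) :
    IsPolyhedronOver K n P := by
  obtain ⟨A, b, rfl⟩ := h
  refine ⟨fun i j => if h : (i : ℕ) < m then A ⟨i, h⟩ j else 0,
    fun i => if h : (i : ℕ) < m then b ⟨i, h⟩ else 0, ?_⟩
  ext x
  simp only [Set.mem_ofPred_eq]
  refine ⟨fun hx i => ?_, fun hx i => ?_⟩
  · by_cases hi : (i : ℕ) < m
    · simpa [hi] using hx ⟨i, hi⟩
    · simp [hi]
  · simpa using hx ⟨i, i.2.trans_le hmn⟩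

theorem IsPolyhedronOver.encard_facets_le {K : Type} [Field K] [Algebra K ℝ] {m d : ℕ}
    {P : Set (Fin d → ℝ)} (h : IsPolyhedronOver K m P) (hfull : vectorSpan ℝ P = ⊤) :
    (facets P).encard ≤ m := by
  obtain ⟨A, b, hP⟩ := h
  exact encard_facets_le_of_inequalities
    (l := fun i => rowFunctional fun j => algebraMap K ℝ (A i j)) (by simpa using hP) hfull

/-- A full-dimensional polyhedron with coefficients in `K` is described by at most as many
inequalities over `K` as it has facets. -/
theorem IsPolyhedronOver.exists_le_encard_facets {K : Type} [Field K] [Algebra K ℝ] {m d : ℕ}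
    {P : Set (Fin d → ℝ)} (h : IsPolyhedronOver K m P) (hne : P.Nonempty)
    (hfull : vectorSpan ℝ P = ⊤) :
    ∃ n : ℕ, IsPolyhedronOver K n P ∧ (n : ℕ∞) ≤ (facets P).encard := by
  classical
  have hex : ∃ m, IsPolyhedronOver K m P := ⟨m, h⟩
  refine ⟨Nat.find hex, Nat.find_spec hex, ?_⟩
  have hmin : ∀ k < Nat.find hex, ¬ IsPolyhedronOver K k P := fun k hk => Nat.find_min hex hk
  obtain ⟨A, b, hP⟩ := Nat.find_spec hex
  revert A b hP hmin
  generalize Nat.find hex = n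
  intro hmin A b hP
  refine le_encard_facets_of_irredundant
    (l := fun i => rowFunctional fun j => algebraMap K ℝ (A i j)) (by simpa using hP) hne hfull
    fun i => ?_
  by_contra! hcon
  simp only [rowFunctional_apply] at hcon
  cases n with
  | zero => exact i.elim0
  | succ n =>
    refine hmin n n.lt_succ_self ⟨fun k => A (i.succAbove k), fun k => b (i.succAbove k), ?_⟩
    rw [hP]
    ext x
    simp only [Set.mem_ofPred_eq]
    refine ⟨fun hx k => hx _, fun hx => ?_⟩
    have hx' : ∀ j, j ≠ i →
        ∑ k, algebraMap K ℝ (A j k) * x k ≤ algebraMap K ℝ (b j) := fun j hj => by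
      obtain ⟨k, rfl⟩ := Fin.exists_succAbove_eq hj
      exact hx k
    intro j
    by_cases hj : j = i
    · exact hj ▸ hcon x hx'
    · exact hx' j hj

/-! ### The combinatorics of slacks -/

section Slack

variable {ι : Type*} {f₁ f₂ f₃ f₄ : ι → ℝ}

/-- Nonnegative slacks `f₁, …, f₄` of points `p u` such that no `p u + p v - p w` with
`u, v ≠ w` satisfies all four inequalities. -/
structure IsHiding (f₁ f₂ f₃ f₄ : ι → ℝ) : Prop where
  nonneg₁ : ∀ u, 0 ≤ f₁ u
  nonneg₂ : ∀ u, 0 ≤ f₂ u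
  nonneg₃ : ∀ u, 0 ≤ f₃ u
  nonneg₄ : ∀ u, 0 ≤ f₄ u
  violated : ∀ u v w, u ≠ w → v ≠ w →
    f₁ u + f₁ v < f₁ w ∨ f₂ u + f₂ v < f₂ w ∨ f₃ u + f₃ v < f₃ w ∨ f₄ u + f₄ v < f₄ w

theorem IsHiding.swap (h : IsHiding f₁ f₂ f₃ f₄) : IsHiding f₃ f₄ f₁ f₂ :=
  ⟨h.3, h.4, h.1, h.2, fun u v w h1 h2 => by have := h.5 u v w h1 h2; tauto⟩

theorem IsHiding.swap_left (h : IsHiding f₁ f₂ f₃ f₄) : IsHiding f₂ f₁ f₃ f₄ :=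
  ⟨h.2, h.1, h.3, h.4, fun u v w h1 h2 => by have := h.5 u v w h1 h2; tauto⟩

theorem IsHiding.swap_right (h : IsHiding f₁ f₂ f₃ f₄) : IsHiding f₁ f₂ f₄ f₃ :=
  h.swap.swap_left.swap

/-- If two points are tight for the same two inequalities, then the two other slacks vary between
the two points in opposite directions, and by more than the slacks of any further point. -/
theorem IsHiding.pair (h : IsHiding f₁ f₂ f₃ f₄) {x y : ι} (hxy : x ≠ y)
    (hx₁ : f₁ x = 0) (hx₃ : f₃ x = 0) (hy₁ : f₁ y = 0) (hy₃ : f₃ y = 0) :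
    (∀ v, v ≠ x → v ≠ y → f₂ v + f₂ y < f₂ x ∧ f₄ v + f₄ x < f₄ y) ∨
    (∀ v, v ≠ x → v ≠ y → f₂ v + f₂ x < f₂ y ∧ f₄ v + f₄ y < f₄ x) := by
  have a1 := h.5 x x y hxy hxy
  have a2 := h.5 y y x hxy.symm hxy.symm
  have n1 := h.2 x
  have n2 := h.2 y
  have n3 := h.4 x
  have n4 := h.4 y
  rw [hx₁, hx₃, hy₁, hy₃] at a1 a2
  by_cases hlt : f₂ y < f₂ x
  · left
    have h4 : f₄ x < f₄ y := by
      rcases a1 with a | a | a | a <;> linarith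
    intro v hvx hvy
    have b1 := h.5 x v y hxy hvy
    have b2 := h.5 y v x hxy.symm hvx
    have m1 := h.1 v
    have m2 := h.2 v
    have m3 := h.3 v
    have m4 := h.4 v
    rw [hx₁, hx₃, hy₁, hy₃] at b1 b2
    constructor
    · rcases b2 with a | a | a | a <;> linarith
    · rcases b1 with a | a | a | a <;> linarith
  · right
    have h4 : f₄ y < f₄ x := by
      rcases a2 with a | a | a | a <;> linarith
    have h2 : f₂ x < f₂ y := by
      rcases a1 with a | a | a | a <;> linarith
    intro v hvx hvy
    have b1 := h.5 x v y hxy hvy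
    have b2 := h.5 y v x hxy.symm hvx
    have m1 := h.1 v
    have m2 := h.2 v
    have m3 := h.3 v
    have m4 := h.4 v
    rw [hx₁, hx₃, hy₁, hy₃] at b1 b2
    constructor
    · rcases b1 with a | a | a | a <;> linarith
    · rcases b2 with a | a | a | a <;> linarith

/-- By `IsHiding.pair`, two points on the same two hyperplanes dominate all others in slack. A
third point on the same two hyperplanes would then make `p x + p y - p w` feasible. -/
theorem IsHiding.not_three (h : IsHiding f₁ f₂ f₃ f₄) {x y w : ι} (hxy : x ≠ y) (hxw : x ≠ w)
    (hyw : y ≠ w) (hx₁ : f₁ x = 0) (hx₃ : f₃ x = 0) (hy₁ : f₁ y = 0) (hy₃ : f₃ y = 0)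
    (hw₁ : f₁ w = 0) (hw₃ : f₃ w = 0) : False := by
  have c := h.5 x y w hxw hyw
  rw [hx₁, hx₃, hy₁, hy₃, hw₁, hw₃] at c
  have n1 := h.2 x
  have n2 := h.2 y
  have n3 := h.4 x
  have n4 := h.4 y
  rcases h.pair hxy hx₁ hx₃ hy₁ hy₃ with p | p <;>
  · have := p w hxw.symm hyw.symm
    rcases c with a | a | a | a <;> linarith

/-- Two disjoint pairs whose common tight inequalities share `f₁` would each have to dominate the
other in the slack `f₂`. -/
theorem IsHiding.not_adjacent_pairs (h : IsHiding f₁ f₂ f₃ f₄) {x y v w : ι} (hxy : x ≠ y)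
    (hvw : v ≠ w) (hxv : x ≠ v) (hxw : x ≠ w) (hyv : y ≠ v) (hyw : y ≠ w)
    (hx₁ : f₁ x = 0) (hx₃ : f₃ x = 0) (hy₁ : f₁ y = 0) (hy₃ : f₃ y = 0)
    (hv₁ : f₁ v = 0) (hv₄ : f₄ v = 0) (hw₁ : f₁ w = 0) (hw₄ : f₄ w = 0) : False := by
  have n1 := h.2 x
  have n2 := h.2 y
  have n3 := h.2 v
  have n4 := h.2 w
  rcases h.pair hxy hx₁ hx₃ hy₁ hy₃ with p | p <;>
  rcases h.swap_right.pair hvw hv₁ hv₄ hw₁ hw₄ with q | q <;>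
  · have p1 := p v hxv.symm hyv.symm
    have p2 := p w hxw.symm hyw.symm
    have q1 := q x hxv hxw
    have q2 := q y hyv hyw
    linarith

/-- With pairs on the hyperplanes of `f₁, f₃` and of `f₂, f₄`, a fifth point `p` tight for `f₁` and
`f₄` is dominated by a point `a` of the first and a point `b` of the second pair, so that
`a + b - p` is feasible. -/
theorem IsHiding.not_opposite_pairs (h : IsHiding f₁ f₂ f₃ f₄) {x y v w p : ι} (hxy : x ≠ y)
    (hvw : v ≠ w) (hpx : p ≠ x) (hpy : p ≠ y) (hpv : p ≠ v) (hpw : p ≠ w)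
    (hx₁ : f₁ x = 0) (hx₃ : f₃ x = 0) (hy₁ : f₁ y = 0) (hy₃ : f₃ y = 0)
    (hv₂ : f₂ v = 0) (hv₄ : f₄ v = 0) (hw₂ : f₂ w = 0) (hw₄ : f₄ w = 0)
    (hp₁ : f₁ p = 0) (hp₄ : f₄ p = 0) : False := by
  have key : ∀ a b, p ≠ a → p ≠ b → f₁ a = 0 → f₂ b = 0 → f₃ a = 0 → f₄ b = 0 →
      f₂ p < f₂ a → f₃ p < f₃ b → False := by
    intro a b ha hb h1 h2 h3 h4 h5 h6
    have n1 := h.1 b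
    have n4 := h.4 a
    rcases h.5 a b p ha.symm hb.symm with c | c | c | c <;> linarith
  have m1 := h.2 x
  have m2 := h.2 y
  have m3 := h.3 v
  have m4 := h.3 w
  rcases h.pair hxy hx₁ hx₃ hy₁ hy₃ with r | r <;>
  rcases h.swap_left.swap_right.pair hvw hv₂ hv₄ hw₂ hw₄ with q | q <;>
  have r1 := r p hpx hpy <;>
  have q1 := q p hpv hpw
  · exact key x w hpx hpw hx₁ hw₂ hx₃ hw₄ (by linarith) (by linarith)
  · exact key x v hpx hpv hx₁ hv₂ hx₃ hv₄ (by linarith) (by linarith)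
  · exact key y w hpy hpw hy₁ hw₂ hy₃ hw₄ (by linarith) (by linarith)
  · exact key y v hpy hpv hy₁ hv₂ hy₃ hv₄ (by linarith) (by linarith)

/-- The four choices of one tight inequality from each of the two pairs divide the points into
classes of size at most two. Adjacent classes cannot both have size two, and opposite classes of
size two leave no point in the remaining ones, so there are at most five points. -/
theorem IsHiding.false_of_six {f₁ f₂ f₃ f₄ : Fin 6 → ℝ} (h : IsHiding f₁ f₂ f₃ f₄)
    (h₁₂ : ∀ u, f₁ u = 0 ∨ f₂ u = 0) (h₃₄ : ∀ u, f₃ u = 0 ∨ f₄ u = 0) : False := by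
  classical
  -- assign to each point one inequality of each of the two pairs that is tight there
  have hc : ∀ u, ∃ c : Bool × Bool, (if c.1 then f₁ u else f₂ u) = 0 ∧
      (if c.2 then f₃ u else f₄ u) = 0 := fun u => by
    rcases h₁₂ u with h1 | h1 <;> rcases h₃₄ u with h3 | h3
    · exact ⟨(true, true), by simp [h1, h3]⟩
    · exact ⟨(true, false), by simp [h1, h3]⟩
    · exact ⟨(false, true), by simp [h1, h3]⟩
    · exact ⟨(false, false), by simp [h1, h3]⟩
  choose c hc1 hc2 using hc
  let S : Bool × Bool → Finset (Fin 6) := fun k => Finset.univ.filter fun u => c u = k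
  have e1 : ∀ {u b}, u ∈ S (true, b) → f₁ u = 0 := fun {u b} hu => by
    have := hc1 u; simp only [S, Finset.mem_filter] at hu; simpa [hu.2] using this
  have e2 : ∀ {u b}, u ∈ S (false, b) → f₂ u = 0 := fun {u b} hu => by
    have := hc1 u; simp only [S, Finset.mem_filter] at hu; simpa [hu.2] using this
  have e3 : ∀ {u b}, u ∈ S (b, true) → f₃ u = 0 := fun {u b} hu => by
    have := hc2 u; simp only [S, Finset.mem_filter] at hu; simpa [hu.2] using this
  have e4 : ∀ {u b}, u ∈ S (b, false) → f₄ u = 0 := fun {u b} hu => by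
    have := hc2 u; simp only [S, Finset.mem_filter] at hu; simpa [hu.2] using this
  have hdis : ∀ {u v k k'}, u ∈ S k → v ∈ S k' → k ≠ k' → u ≠ v := by
    rintro u v k k' hu hv hk rfl
    simp only [S, Finset.mem_filter] at hu hv
    exact hk (hu.2.symm.trans hv.2)
  have hsum : (S (true, true)).card + (S (true, false)).card + (S (false, true)).card
      + (S (false, false)).card = 6 := by
    have := Finset.card_eq_sum_card_fiberwise (f := c) (s := Finset.univ) (t := Finset.univ)
      (fun _ _ => Finset.mem_coe.2 (Finset.mem_univ _))
    rw [Fintype.sum_prod_type] at this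
    simp only [Fintype.sum_bool, Finset.card_univ, Fintype.card_fin] at this
    simp only [S]
    omega
  have b13 : (S (true, true)).card ≤ 2 := by
    by_contra! hlt
    obtain ⟨x, hx, y, hy, w, hw, h1, h2, h3⟩ := Finset.two_lt_card.1 hlt
    exact h.not_three h1 h2 h3 (e1 hx) (e3 hx) (e1 hy) (e3 hy) (e1 hw) (e3 hw)
  have b14 : (S (true, false)).card ≤ 2 := by
    by_contra! hlt
    obtain ⟨x, hx, y, hy, w, hw, h1, h2, h3⟩ := Finset.two_lt_card.1 hlt
    exact h.swap_right.not_three h1 h2 h3 (e1 hx) (e4 hx) (e1 hy) (e4 hy) (e1 hw) (e4 hw)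
  have b23 : (S (false, true)).card ≤ 2 := by
    by_contra! hlt
    obtain ⟨x, hx, y, hy, w, hw, h1, h2, h3⟩ := Finset.two_lt_card.1 hlt
    exact h.swap_left.not_three h1 h2 h3 (e2 hx) (e3 hx) (e2 hy) (e3 hy) (e2 hw) (e3 hw)
  have b24 : (S (false, false)).card ≤ 2 := by
    by_contra! hlt
    obtain ⟨x, hx, y, hy, w, hw, h1, h2, h3⟩ := Finset.two_lt_card.1 hlt
    exact h.swap_left.swap_right.not_three h1 h2 h3 (e2 hx) (e4 hx) (e2 hy) (e4 hy)
      (e2 hw) (e4 hw)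
  have a1 : ¬ (1 < (S (true, true)).card ∧ 1 < (S (true, false)).card) := by
    rintro ⟨hl, hr⟩
    obtain ⟨x, hx, y, hy, hxy⟩ := Finset.one_lt_card.1 hl
    obtain ⟨v, hv, w, hw, hvw⟩ := Finset.one_lt_card.1 hr
    exact h.not_adjacent_pairs hxy hvw (hdis hx hv (by simp)) (hdis hx hw (by simp))
      (hdis hy hv (by simp)) (hdis hy hw (by simp)) (e1 hx) (e3 hx) (e1 hy) (e3 hy)
      (e1 hv) (e4 hv) (e1 hw) (e4 hw)
  have a2 : ¬ (1 < (S (false, true)).card ∧ 1 < (S (false, false)).card) := by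
    rintro ⟨hl, hr⟩
    obtain ⟨x, hx, y, hy, hxy⟩ := Finset.one_lt_card.1 hl
    obtain ⟨v, hv, w, hw, hvw⟩ := Finset.one_lt_card.1 hr
    exact h.swap_left.not_adjacent_pairs hxy hvw (hdis hx hv (by simp)) (hdis hx hw (by simp))
      (hdis hy hv (by simp)) (hdis hy hw (by simp)) (e2 hx) (e3 hx) (e2 hy) (e3 hy)
      (e2 hv) (e4 hv) (e2 hw) (e4 hw)
  have a3 : ¬ (1 < (S (true, true)).card ∧ 1 < (S (false, true)).card) := by
    rintro ⟨hl, hr⟩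
    obtain ⟨x, hx, y, hy, hxy⟩ := Finset.one_lt_card.1 hl
    obtain ⟨v, hv, w, hw, hvw⟩ := Finset.one_lt_card.1 hr
    exact h.swap.not_adjacent_pairs hxy hvw (hdis hx hv (by simp)) (hdis hx hw (by simp))
      (hdis hy hv (by simp)) (hdis hy hw (by simp)) (e3 hx) (e1 hx) (e3 hy) (e1 hy)
      (e3 hv) (e2 hv) (e3 hw) (e2 hw)
  have a4 : ¬ (1 < (S (true, false)).card ∧ 1 < (S (false, false)).card) := by
    rintro ⟨hl, hr⟩
    obtain ⟨x, hx, y, hy, hxy⟩ := Finset.one_lt_card.1 hl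
    obtain ⟨v, hv, w, hw, hvw⟩ := Finset.one_lt_card.1 hr
    exact h.swap_right.swap.not_adjacent_pairs hxy hvw (hdis hx hv (by simp))
      (hdis hx hw (by simp)) (hdis hy hv (by simp)) (hdis hy hw (by simp)) (e4 hx) (e1 hx)
      (e4 hy) (e1 hy) (e4 hv) (e2 hv) (e4 hw) (e2 hw)
  have a5 : ¬ (1 < (S (true, true)).card ∧ 1 < (S (false, false)).card ∧
      0 < (S (true, false)).card) := by
    rintro ⟨hl, hr, hp⟩
    obtain ⟨x, hx, y, hy, hxy⟩ := Finset.one_lt_card.1 hl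
    obtain ⟨v, hv, w, hw, hvw⟩ := Finset.one_lt_card.1 hr
    obtain ⟨p, hp⟩ := Finset.card_pos.1 hp
    exact h.not_opposite_pairs hxy hvw (hdis hp hx (by simp)) (hdis hp hy (by simp))
      (hdis hp hv (by simp)) (hdis hp hw (by simp)) (e1 hx) (e3 hx) (e1 hy) (e3 hy)
      (e2 hv) (e4 hv) (e2 hw) (e4 hw) (e1 hp) (e4 hp)
  have a6 : ¬ (1 < (S (true, false)).card ∧ 1 < (S (false, true)).card ∧
      0 < (S (true, true)).card) := by
    rintro ⟨hl, hr, hp⟩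
    obtain ⟨x, hx, y, hy, hxy⟩ := Finset.one_lt_card.1 hl
    obtain ⟨v, hv, w, hw, hvw⟩ := Finset.one_lt_card.1 hr
    obtain ⟨p, hp⟩ := Finset.card_pos.1 hp
    exact h.swap_right.not_opposite_pairs hxy hvw (hdis hp hx (by simp)) (hdis hp hy (by simp))
      (hdis hp hv (by simp)) (hdis hp hw (by simp)) (e1 hx) (e4 hx) (e1 hy) (e4 hy)
      (e2 hv) (e3 hv) (e2 hw) (e3 hw) (e1 hp) (e3 hp)
  omega

end Slack

/-! ### Lower bounds on the number of facets -/

/-- Dirichlet approximation: fewer than `d` linear functionals on `ℝ^d` are simultaneously small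
on some large integer vector. -/
theorem exists_large_int_small {m d : ℕ} (hmd : m < d)
    (l : Fin m → (Fin d → ℝ) →ₗ[ℝ] ℝ) (N : ℕ) {δ : ℝ} (hδ : 0 < δ) :
    ∃ z : Fin d → ℤ, (∃ j, (N : ℤ) < |z j|) ∧ ∀ i, |l i fun j => (z j : ℝ)| < δ := by
  let Λ : (Fin d → ℝ) →ₗ[ℝ] (Fin m → ℝ) := LinearMap.pi l
  have hker : LinearMap.ker Λ ≠ ⊥ := LinearMap.ker_ne_bot_of_finrank_lt (by simpa using hmd)
  obtain ⟨u', hu', hu0⟩ := Submodule.exists_mem_ne_zero_of_ne_bot hker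
  obtain ⟨j, hj⟩ : ∃ j, u' j ≠ 0 := by
    by_contra! h
    exact hu0 (funext h)
  -- scaled so that the `j`-th coordinate of `⌊n u⌋ - ⌊n' u⌋` is a nonzero multiple of `N + 1`
  set u : Fin d → ℝ := ((N + 1 : ℝ) / u' j) • u' with hu
  have huj : u j = N + 1 := by simp [hu, hj]
  have hΛu : Λ u = 0 := by
    rw [hu, map_smul, LinearMap.mem_ker.1 hu', smul_zero]
  have hfr : ∀ n : ℕ, (fun k => Int.fract ((n : ℝ) * u k)) ∈ Set.Icc (0 : Fin d → ℝ) 1 :=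
    fun n => ⟨fun k => Int.fract_nonneg _, fun k => (Int.fract_lt_one _).le⟩
  obtain ⟨a, -, φ, hφ, hlim⟩ := isCompact_Icc.tendsto_subseq hfr
  have hlim' := (LinearMap.continuous_of_finiteDimensional Λ).continuousAt.tendsto.comp hlim
  obtain ⟨M, hM⟩ := Metric.cauchySeq_iff.1 hlim'.cauchySeq δ hδ
  have hd := hM (M + 1) (Nat.le_succ M) M le_rfl
  have hlt : φ M < φ (M + 1) := hφ M.lt_succ_self
  refine ⟨fun k => ⌊(φ (M + 1) : ℝ) * u k⌋ - ⌊(φ M : ℝ) * u k⌋, ⟨j, ?_⟩, fun i => ?_⟩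
  · have hf : ∀ n : ℕ, ⌊(n : ℝ) * u j⌋ = (n : ℤ) * (N + 1) := fun n => by
      rw [huj]
      exact_mod_cast Int.floor_intCast (R := ℝ) ((n : ℤ) * (N + 1))
    show (N : ℤ) < |⌊(φ (M + 1) : ℝ) * u j⌋ - ⌊(φ M : ℝ) * u j⌋|
    rw [hf, hf, ← sub_mul, abs_mul]
    have h1 : (1 : ℤ) ≤ |((φ (M + 1) : ℕ) : ℤ) - (φ M : ℕ)| := by
      rw [abs_of_pos (by omega)]; omega
    have h2 : |((N : ℤ) + 1)| = N + 1 := abs_of_nonneg (by omega)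
    rw [h2]
    nlinarith
  · rw [dist_eq_norm] at hd
    have hi := (norm_le_pi_norm _ i).trans_lt hd
    have hz : (fun k => ((⌊(φ (M + 1) : ℝ) * u k⌋ - ⌊(φ M : ℝ) * u k⌋ : ℤ) : ℝ)) =
        (((φ (M + 1) : ℝ) - φ M) • u) - ((fun k => Int.fract ((φ (M + 1) : ℝ) * u k)) -
          fun k => Int.fract ((φ M : ℝ) * u k)) := by
      ext k
      simp only [Pi.sub_apply, Pi.smul_apply, smul_eq_mul, Int.fract, Int.cast_sub]
      ring
    have hu_i : l i u = 0 := congrFun hΛu i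
    rw [hz, map_sub, map_smul, hu_i, smul_zero, zero_sub, abs_neg, map_sub]
    simpa [Λ] using hi

theorem add_sub_notMem_range {n d : ℕ} {p : Fin n → Fin d → ℝ}
    (hp : AffineIndependent ℝ p) {u v w : Fin n} (hu : u ≠ w) (hv : v ≠ w) :
    p u + p v - p w ∉ Set.range p := by
  rintro ⟨t, ht⟩
  have := (affineIndependent_iff.1 hp) Finset.univ
    (Pi.single u 1 + Pi.single v 1 - Pi.single w 1 - Pi.single t 1)
    (by simp [Finset.sum_add_distrib])
    (by
      simp only [Pi.sub_apply, Pi.add_apply, sub_smul, add_smul, Finset.sum_sub_distrib,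
        Finset.sum_add_distrib, Pi.single_apply, ite_smul, one_smul, zero_smul,
        Finset.sum_ite_eq', Finset.mem_univ, if_true]
      rw [← ht, sub_self]) w (Finset.mem_univ _)
  simp only [Pi.sub_apply, Pi.add_apply, Pi.single_apply, hu.symm, hv.symm, if_true,
    if_false] at this
  split_ifs at this <;> norm_num at this

theorem vectorSpan_range_eq_top {p : Fin 6 → Fin 5 → ℝ} (hp : AffineIndependent ℝ p) :
    vectorSpan ℝ (Set.range p) = ⊤ :=
  hp.vectorSpan_eq_top_of_card_eq_finrank_add_one (by simp)

/-- Four inequalities never suffice: for a large integer vector `z` on which the four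
functionals are small, `p u + z` and `p u - z` are cut off by inequalities tight at `p u`, which
forces two inequalities with positive and two with negative value at `z`. -/
theorem not_isPolyhedronOver_four {p : Fin 6 → Fin 5 → ℝ} (hp : AffineIndependent ℝ p)
    {P : Set (Fin 5 → ℝ)} (hX : P ∩ integerPoints 5 = Set.range p) :
    ¬ IsPolyhedronOver ℝ 4 P := by
  rintro ⟨A, b, hP⟩
  let l : Fin 4 → (Fin 5 → ℝ) →ₗ[ℝ] ℝ := fun i => rowFunctional (A i)
  have hmem : ∀ x, x ∈ P ↔ ∀ i, l i x ≤ b i := fun x => by rw [hP]; simp [l]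
  have hpP : ∀ u, p u ∈ P ∩ integerPoints 5 := fun u => hX ▸ ⟨u, rfl⟩
  have hint : ∀ u j, ∃ z : ℤ, p u j = z := fun u => (hpP u).2
  let s : Fin 4 → Fin 6 → ℝ := fun i u => b i - l i (p u)
  have hs : ∀ i u, 0 ≤ s i u := fun i u => sub_nonneg.2 ((hmem _).1 (hpP u).1 i)
  obtain ⟨δ, hδs, hδ⟩ : ∃ δ : ℝ, (∀ i u, 0 < s i u → δ ≤ s i u) ∧ 0 < δ := by
    have key : ∀ᶠ δ : ℝ in nhdsWithin 0 (Set.Ioi 0), ∀ i u, 0 < s i u → δ ≤ s i u := by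
      refine Filter.eventually_all.2 fun i => Filter.eventually_all.2 fun u => ?_
      by_cases h : 0 < s i u
      · filter_upwards [nhdsWithin_le_nhds (Iio_mem_nhds h)] with δ hδ _ using le_of_lt hδ
      · exact Filter.Eventually.of_forall fun _ h' => absurd h' h
    exact (key.and self_mem_nhdsWithin).exists
  -- translating by a vector with an entry beyond `N` leaves the finite set `Set.range p`
  obtain ⟨N, hN⟩ : ∃ N : ℕ, ∀ u v j, |p u j - p v j| ≤ N := by
    obtain ⟨N, hN⟩ := exists_nat_ge (∑ u, ∑ v, ∑ j, |p u j - p v j|)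
    refine ⟨N, fun u v j => le_trans ?_ hN⟩
    refine le_trans ?_ (Finset.single_le_sum (fun u _ => by positivity) (Finset.mem_univ u))
    refine le_trans ?_ (Finset.single_le_sum (fun v _ => by positivity) (Finset.mem_univ v))
    exact Finset.single_le_sum (f := fun j => |p u j - p v j|) (fun j _ => by positivity)
      (Finset.mem_univ j)
  obtain ⟨z, ⟨j, hzj⟩, hz⟩ := exists_large_int_small (by norm_num : 4 < 5) l N hδ
  set ζ : Fin 5 → ℝ := fun j => (z j : ℝ) with hζ
  have hzj' : (N : ℝ) < |ζ j| := by simp only [hζ]; exact_mod_cast hzj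
  -- the change of slack along `ζ` is below `δ`, so only an inequality tight at `p u` can cut off
  -- `p u ± ζ`
  have htight : ∀ u, ∀ ε : ℤ, ε = 1 ∨ ε = -1 → ∃ i, s i u = 0 ∧ 0 < (ε : ℝ) * l i ζ := by
    intro u ε hε
    have habs : |(ε : ℝ)| = 1 := by rcases hε with rfl | rfl <;> simp
    have hnot : p u + (ε : ℝ) • ζ ∉ P := fun hin => by
      have : p u + (ε : ℝ) • ζ ∈ Set.range p := hX ▸ ⟨hin, fun k => by
        obtain ⟨a, ha⟩ := hint u k
        exact ⟨a + ε * z k, by simp [ha, hζ]⟩⟩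
      obtain ⟨v, hv⟩ := this
      have h1 := hN v u j
      rw [hv] at h1
      simp only [Pi.add_apply, Pi.smul_apply, smul_eq_mul, add_sub_cancel_left, abs_mul, habs,
        one_mul] at h1
      linarith
    rw [hmem] at hnot
    push Not at hnot
    obtain ⟨i, hi⟩ := hnot
    rw [map_add, map_smul, smul_eq_mul] at hi
    have hlt : s i u < (ε : ℝ) * l i ζ := by simp only [s]; linarith
    have hsmall : (ε : ℝ) * l i ζ < δ := by
      refine (le_abs_self _).trans_lt ?_
      rw [abs_mul, habs, one_mul]
      exact hz i
    refine ⟨i, ?_, (hs i u).trans_lt hlt⟩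
    by_contra h0
    linarith [hδs i u (lt_of_le_of_ne (hs i u) (Ne.symm h0))]
  have hpos : ∀ u, ∃ i, s i u = 0 ∧ 0 < l i ζ := fun u => by
    simpa using htight u 1 (Or.inl rfl)
  have hneg : ∀ u, ∃ i, s i u = 0 ∧ l i ζ < 0 := fun u => by
    simpa using htight u (-1) (Or.inr rfl)
  have hnt : ∀ i, l i ζ ≠ 0 → ∃ u, s i u ≠ 0 := fun i hi => by
    by_contra! h
    refine hi ?_
    rw [eq_zero_of_const_on_spanning (vectorSpan_range_eq_top hp) (l := l i) (c := b i)
      (by rintro _ ⟨u, rfl⟩; linarith [h u]), LinearMap.zero_apply]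
  obtain ⟨i₁, -, h₁⟩ := hpos 0
  obtain ⟨u₁, hu₁⟩ := hnt i₁ h₁.ne'
  obtain ⟨i₂, h₂', h₂⟩ := hpos u₁
  have h12 : i₁ ≠ i₂ := by rintro rfl; exact hu₁ h₂'
  obtain ⟨i₃, -, h₃⟩ := hneg 0
  obtain ⟨u₃, hu₃⟩ := hnt i₃ h₃.ne
  obtain ⟨i₄, h₄', h₄⟩ := hneg u₃
  have h34 : i₃ ≠ i₄ := by rintro rfl; exact hu₃ h₄'
  have h13 : i₁ ≠ i₃ := by rintro rfl; linarith
  have h14 : i₁ ≠ i₄ := by rintro rfl; linarith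
  have h23 : i₂ ≠ i₃ := by rintro rfl; linarith
  have h24 : i₂ ≠ i₄ := by rintro rfl; linarith
  have hall : ∀ i, i = i₁ ∨ i = i₂ ∨ i = i₃ ∨ i = i₄ := by
    intro i
    omega
  refine IsHiding.false_of_six (f₁ := s i₁) (f₂ := s i₂) (f₃ := s i₃) (f₄ := s i₄)
    ⟨hs _, hs _, hs _, hs _, fun u v w hu hv => ?_⟩ (fun u => ?_) (fun u => ?_)
  · have hnot : p u + p v - p w ∉ P := fun hin =>
      add_sub_notMem_range hp hu hv (hX ▸ ⟨hin, fun k => by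
        obtain ⟨a, ha⟩ := hint u k
        obtain ⟨a', ha'⟩ := hint v k
        obtain ⟨a'', ha''⟩ := hint w k
        exact ⟨a + a' - a'', by simp [ha, ha', ha'']⟩⟩)
    rw [hmem] at hnot
    push Not at hnot
    obtain ⟨i, hi⟩ := hnot
    rw [map_sub, map_add] at hi
    have : s i u + s i v < s i w := by simp only [s]; linarith
    rcases hall i with rfl | rfl | rfl | rfl <;> tauto
  · obtain ⟨i, hi, hi'⟩ := hpos u
    rcases hall i with rfl | rfl | rfl | rfl
    · exact Or.inl hi
    · exact Or.inr hi
    · linarith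
    · linarith
  · obtain ⟨i, hi, hi'⟩ := hneg u
    rcases hall i with rfl | rfl | rfl | rfl
    · linarith
    · linarith
    · exact Or.inl hi
    · exact Or.inr hi

/-- Five rational inequalities never suffice: the homogeneous system has a nonzero rational, hence
a nonzero integer, solution, along which every integer point can be translated. -/
theorem not_isPolyhedronOver_rat_five {p : Fin 6 → Fin 5 → ℝ} {P : Set (Fin 5 → ℝ)}
    (hX : P ∩ integerPoints 5 = Set.range p) : ¬ IsPolyhedronOver ℚ 5 P := by
  rintro ⟨A, b, hP⟩
  obtain ⟨v, hv0, hv⟩ : ∃ v : Fin 5 → ℚ, v ≠ 0 ∧ ∀ i, (A.mulVec v) i ≤ 0 := by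
    -- a kernel vector if `A` is singular, and otherwise the solution of `A v = -1`
    by_cases hdet : A.det = 0
    · obtain ⟨v, hv0, hv⟩ := Matrix.exists_mulVec_eq_zero_iff.2 hdet
      exact ⟨v, hv0, fun i => by rw [hv]; rfl⟩
    · have hsol : A.mulVec (A⁻¹.mulVec fun _ => -1) = fun _ => -1 := by
        rw [Matrix.mulVec_mulVec, Matrix.mul_nonsing_inv _ (Ne.isUnit hdet), Matrix.one_mulVec]
      refine ⟨A⁻¹.mulVec fun _ => -1, fun h => ?_, fun i => by rw [hsol]; norm_num⟩
      rw [h, Matrix.mulVec_zero] at hsol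
      have := congrFun hsol 0
      norm_num at this
  obtain ⟨D, hD⟩ := IsLocalization.exist_integer_multiples_of_finset (nonZeroDivisors ℤ)
    (Finset.univ.image v)
  have hD0 : (D : ℤ) ≠ 0 := nonZeroDivisors.coe_ne_zero D
  have hw : ∀ j, ∃ w : ℤ, (w : ℚ) = (|(D : ℤ)| : ℤ) * v j := fun j => by
    obtain ⟨w, hw⟩ := hD (v j) (Finset.mem_image_of_mem v (Finset.mem_univ j))
    have hw' : (w : ℚ) = (D : ℤ) * v j := by simpa [Submonoid.smul_def] using hw
    rcases abs_choice (D : ℤ) with h | h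
    · exact ⟨w, by rw [h, hw']⟩
    · exact ⟨-w, by rw [h]; push_cast; rw [hw']; ring⟩
  choose w hw using hw
  have hDpos : (0 : ℚ) < (|(D : ℤ)| : ℤ) := by exact_mod_cast abs_pos.2 hD0
  obtain ⟨j, hj⟩ : ∃ j, w j ≠ 0 := by
    by_contra! h
    refine hv0 (funext fun j => ?_)
    have := hw j
    rw [h j, Int.cast_zero] at this
    exact (mul_eq_zero.1 this.symm).resolve_left hDpos.ne'
  have hrec : ∀ i, ∑ k, A i k * (w k : ℚ) ≤ 0 := fun i => by
    have h1 := hv i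
    rw [Matrix.mulVec, dotProduct] at h1
    have : ∑ k, A i k * (w k : ℚ) = (|(D : ℤ)| : ℤ) * ∑ k, A i k * v k := by
      rw [Finset.mul_sum]
      exact Finset.sum_congr rfl fun k _ => by rw [hw]; ring
    rw [this]
    exact mul_nonpos_of_nonneg_of_nonpos hDpos.le h1
  have hrecR : ∀ i, ∑ k, (A i k : ℝ) * (w k : ℝ) ≤ 0 := fun i => by exact_mod_cast hrec i
  have hpP : p 0 ∈ P ∩ integerPoints 5 := hX ▸ ⟨0, rfl⟩
  have hin : ∀ n : ℕ, p 0 + (n : ℝ) • (fun k => (w k : ℝ)) ∈ Set.range p := fun n => by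
    rw [← hX]
    refine ⟨?_, fun k => ?_⟩
    · have h0 := hpP.1
      rw [hP] at h0 ⊢
      intro i
      have h1 := h0 i
      have h2 := hrecR i
      simp only [Pi.add_apply, Pi.smul_apply, smul_eq_mul, mul_add, Finset.sum_add_distrib]
      have : ∑ k, algebraMap ℚ ℝ (A i k) * ((n : ℝ) * (w k : ℝ)) =
          n * ∑ k, (A i k : ℝ) * (w k : ℝ) := by
        rw [Finset.mul_sum]
        exact Finset.sum_congr rfl fun k _ => by simp only [eq_ratCast]; ring
      rw [this]
      have h3 : (0 : ℝ) ≤ n := Nat.cast_nonneg n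
      nlinarith
    · obtain ⟨a, ha⟩ := hpP.2 k
      exact ⟨a + n * w k, by simp [ha]⟩
  have hinj : Function.Injective fun n : ℕ => p 0 + (n : ℝ) • (fun k => (w k : ℝ)) := by
    intro n n' h
    have h' := congrFun h j
    simp only [Pi.add_apply, Pi.smul_apply, smul_eq_mul, add_right_inj] at h'
    have hj' : (w j : ℝ) ≠ 0 := by exact_mod_cast hj
    exact_mod_cast mul_right_cancel₀ hj' h'
  exact Set.infinite_range_of_injective hinj
    ((Set.finite_range p).subset (Set.range_subset_iff.2 hin))

theorem vectorSpan_eq_top_of_range {p : Fin 6 → Fin 5 → ℝ} (hp : AffineIndependent ℝ p)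
    {P : Set (Fin 5 → ℝ)} (hX : P ∩ integerPoints 5 = Set.range p) : vectorSpan ℝ P = ⊤ :=
  top_le_iff.1 (vectorSpan_range_eq_top hp ▸
    vectorSpan_mono ℝ (hX ▸ Set.inter_subset_left))

theorem five_le_encard_facets {p : Fin 6 → Fin 5 → ℝ} (hp : AffineIndependent ℝ p)
    {P : Set (Fin 5 → ℝ)} (hX : P ∩ integerPoints 5 = Set.range p) (hP : IsPolyhedron P) :
    5 ≤ (facets P).encard := by
  obtain ⟨m, hm⟩ := hP
  have hne : P.Nonempty := ⟨p 0, (hX ▸ ⟨0, rfl⟩ : p 0 ∈ P ∩ integerPoints 5).1⟩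
  obtain ⟨n, hn, hle⟩ := hm.exists_le_encard_facets hne (vectorSpan_eq_top_of_range hp hX)
  refine le_trans ?_ hle
  by_contra hlt
  have hlt' : n < 5 := by
    rw [not_le] at hlt
    exact_mod_cast hlt
  exact not_isPolyhedronOver_four hp hX (hn.mono (by omega))

theorem six_le_encard_facets {p : Fin 6 → Fin 5 → ℝ} (hp : AffineIndependent ℝ p)
    {P : Set (Fin 5 → ℝ)} (hX : P ∩ integerPoints 5 = Set.range p)
    (hP : IsRationalPolyhedron P) : 6 ≤ (facets P).encard := by
  obtain ⟨m, hm⟩ := hP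
  have hne : P.Nonempty := ⟨p 0, (hX ▸ ⟨0, rfl⟩ : p 0 ∈ P ∩ integerPoints 5).1⟩
  obtain ⟨n, hn, hle⟩ := hm.exists_le_encard_facets hne (vectorSpan_eq_top_of_range hp hX)
  refine le_trans ?_ hle
  by_contra hlt
  have hlt' : n < 6 := by
    rw [not_le] at hlt
    exact_mod_cast hlt
  exact not_isPolyhedronOver_rat_five hX (hn.mono (by omega))

/-! ### The simplex and its unimodular image -/

theorem forall_fin_five {p : Fin 5 → Prop} : (∀ i, p i) ↔ p 0 ∧ p 1 ∧ p 2 ∧ p 3 ∧ p 4 :=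
  ⟨fun h => ⟨h 0, h 1, h 2, h 3, h 4⟩, fun ⟨h0, h1, h2, h3, h4⟩ i => by
    fin_cases i <;> assumption⟩

theorem forall_fin_six {p : Fin 6 → Prop} :
    (∀ i, p i) ↔ p 0 ∧ p 1 ∧ p 2 ∧ p 3 ∧ p 4 ∧ p 5 :=
  ⟨fun h => ⟨h 0, h 1, h 2, h 3, h 4, h 5⟩, fun ⟨h0, h1, h2, h3, h4, h5⟩ i => by
    fin_cases i <;> assumption⟩

/-- The matrix of the unimodular map of `ℝ^5` taking the standard simplex to `simplexDelta`. -/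
def deltaMatrix : Matrix (Fin 5) (Fin 5) ℝ :=
  !![1, 0, 0, 1, 0; 0, 1, 0, 0, 1; 0, 0, 1, 1, 1; 0, 0, 0, 1, 0; 0, 0, 0, 0, 1]

theorem deltaMatrix_mulVec (x : Fin 5 → ℝ) :
    deltaMatrix.mulVec x = ![x 0 + x 3, x 1 + x 4, x 2 + x 3 + x 4, x 3, x 4] := by
  ext i
  fin_cases i <;> simp [deltaMatrix, Matrix.mulVec, dotProduct, Fin.sum_univ_five]

theorem deltaMatrix_mulVec_injective : Function.Injective deltaMatrix.mulVec := by
  intro x y h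
  rw [deltaMatrix_mulVec, deltaMatrix_mulVec] at h
  have h0 := congrFun h 0
  have h1 := congrFun h 1
  have h2 := congrFun h 2
  have h3 := congrFun h 3
  have h4 := congrFun h 4
  simp at h0 h1 h2 h3 h4
  ext i
  fin_cases i <;> simp <;> linarith

theorem deltaMatrix_mulVec_mem_integerPoints {x : Fin 5 → ℝ} (hx : x ∈ integerPoints 5) :
    deltaMatrix.mulVec x ∈ integerPoints 5 := by
  choose z hz using hx
  rw [deltaMatrix_mulVec]
  refine fun i => ⟨![z 0 + z 3, z 1 + z 4, z 2 + z 3 + z 4, z 3, z 4] i, ?_⟩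
  fin_cases i <;> simp [hz]

theorem deltaMatrix_image_integerPoints :
    deltaMatrix.mulVec '' integerPoints 5 = integerPoints 5 := by
  refine Set.Subset.antisymm ?_ fun y hy => ?_
  · rintro _ ⟨x, hx, rfl⟩
    exact deltaMatrix_mulVec_mem_integerPoints hx
  · choose z hz using hy
    refine ⟨![y 0 - y 3, y 1 - y 4, y 2 - y 3 - y 4, y 3, y 4], fun i =>
      ⟨![z 0 - z 3, z 1 - z 4, z 2 - z 3 - z 4, z 3, z 4] i, ?_⟩, ?_⟩
    · fin_cases i <;> simp [hz]
    · rw [deltaMatrix_mulVec]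
      ext i
      fin_cases i <;> simp
      ring

theorem simplexVertices_five : simplexVertices 5 =
    {0, ![1, 0, 0, 0, 0], ![0, 1, 0, 0, 0], ![0, 0, 1, 0, 0], ![0, 0, 0, 1, 0],
      ![0, 0, 0, 0, 1]} := by
  have e : ∀ i : Fin 5, (Pi.single i 1 : Fin 5 → ℝ) =
      ![![1, 0, 0, 0, 0], ![0, 1, 0, 0, 0], ![0, 0, 1, 0, 0], ![0, 0, 0, 1, 0],
        ![0, 0, 0, 0, 1]] i := by
    intro i
    ext j
    fin_cases i <;> fin_cases j <;> simp
  ext x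
  simp only [simplexVertices, e, Set.mem_insert_iff, Set.mem_range, Set.mem_singleton_iff,
    Fin.exists_fin_succ, Fin.exists_fin_zero]
  simp [eq_comm]

theorem deltaMatrix_image_simplexVertices :
    deltaMatrix.mulVec '' simplexVertices 5 = simplexDelta := by
  rw [simplexVertices_five]
  simp only [Set.image_insert_eq, Set.image_singleton, deltaMatrix_mulVec, simplexDelta]
  have : (![(0 : Fin 5 → ℝ) 0 + (0 : Fin 5 → ℝ) 3, (0 : Fin 5 → ℝ) 1 + (0 : Fin 5 → ℝ) 4,
    (0 : Fin 5 → ℝ) 2 + (0 : Fin 5 → ℝ) 3 + (0 : Fin 5 → ℝ) 4, (0 : Fin 5 → ℝ) 3,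
    (0 : Fin 5 → ℝ) 4]) = 0 := by
    ext i; fin_cases i <;> simp
  rw [this]
  simp

theorem unimodularlyEquivalent_simplexDelta :
    UnimodularlyEquivalent (simplexVertices 5) simplexDelta :=
  ⟨(Matrix.toLin' deltaMatrix).toAffineMap, deltaMatrix_image_integerPoints,
    deltaMatrix_image_simplexVertices⟩

/-- The vertices of the standard simplex as an indexed family, the origin first. -/
def simplexFamily : Fin 6 → Fin 5 → ℝ :=
  Fin.cons 0 fun i : Fin 5 => (Pi.single i 1 : Fin 5 → ℝ)

theorem range_simplexFamily : Set.range simplexFamily = simplexVertices 5 :=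
  Fin.range_cons _ _

theorem affineIndependent_simplexFamily : AffineIndependent ℝ simplexFamily := by
  rw [affineIndependent_iff]
  intro s w hw hs
  suffices H : ∀ i : Fin 5, i.succ ∈ s → w i.succ = 0 by
    intro i hi
    revert hi
    refine Fin.cases (fun hi => ?_) (fun j => H j) i
    rw [← hw, eq_comm]
    refine Finset.sum_eq_single_of_mem _ hi fun k hk hne => ?_
    obtain ⟨j, rfl⟩ := Fin.exists_succ_eq.2 hne
    exact H j hk
  intro i hi
  have h := congrFun hs i
  rw [Finset.sum_apply, Finset.sum_eq_single_of_mem _ hi] at h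
  · simpa [simplexFamily] using h
  · intro k _ hne
    revert hne
    refine Fin.cases (fun _ => ?_) (fun j hne => ?_) k
    · simp [simplexFamily]
    · have : i ≠ j := fun h => hne (by rw [h])
      simp [simplexFamily, this]

theorem affineIndependent_deltaFamily :
    AffineIndependent ℝ (deltaMatrix.mulVec ∘ simplexFamily) :=
  affineIndependent_simplexFamily.map' (Matrix.toLin' deltaMatrix).toAffineMap
    deltaMatrix_mulVec_injective

theorem range_deltaFamily : Set.range (deltaMatrix.mulVec ∘ simplexFamily) = simplexDelta := by
  rw [Set.range_comp, range_simplexFamily, deltaMatrix_image_simplexVertices]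

theorem simplexVertices_subset_integerPoints : simplexVertices 5 ⊆ integerPoints 5 := by
  rintro x (rfl | ⟨i, rfl⟩) j
  · exact ⟨0, by simp⟩
  · by_cases h : j = i
    · subst h; exact ⟨1, by simp⟩
    · exact ⟨0, by simp [h]⟩

theorem IsPolyhedronOver.preimage_mulVec {m d e : ℕ} {P : Set (Fin e → ℝ)}
    (h : IsPolyhedronOver ℝ m P) (M : Matrix (Fin e) (Fin d) ℝ) :
    IsPolyhedronOver ℝ m (M.mulVec ⁻¹' P) := by
  obtain ⟨A, b, rfl⟩ := h
  refine ⟨A * M, b, ?_⟩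
  ext x
  have := fun i => congrFun (Matrix.mulVec_mulVec x A M) i
  simp only [Matrix.mulVec, dotProduct] at this
  simp [← this, Matrix.mulVec, dotProduct]

/-- The rational relaxation `{x ≥ 0, ∑ x_j ≤ 1}` with six inequalities. -/
theorem exists_rational_relaxation : ∃ P : Set (Fin 5 → ℝ), IsPolyhedronOver ℚ 6 P ∧
    P ∩ integerPoints 5 = simplexVertices 5 := by
  refine ⟨_, ⟨!![-1, 0, 0, 0, 0; 0, -1, 0, 0, 0; 0, 0, -1, 0, 0; 0, 0, 0, -1, 0; 0, 0, 0, 0, -1;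
    1, 1, 1, 1, 1], ![0, 0, 0, 0, 0, 1], rfl⟩, ?_⟩
  ext x
  simp only [Set.mem_inter_iff, Set.mem_ofPred_eq, forall_fin_six, Fin.sum_univ_five]
  simp only [Matrix.of_apply, Matrix.cons_val]
  simp only [map_neg, map_one, map_zero, neg_mul, one_mul, zero_mul, add_zero, zero_add,
    Left.neg_nonpos_iff]
  constructor
  · rintro ⟨⟨h0, h1, h2, h3, h4, hs⟩, hx⟩
    choose z hz using hx
    rw [hz] at h0 h1 h2 h3 h4
    rw [hz, hz, hz, hz, hz] at hs
    norm_cast at h0 h1 h2 h3 h4 hs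
    have hx : x = ![(z 0 : ℝ), (z 1 : ℝ), (z 2 : ℝ), (z 3 : ℝ), (z 4 : ℝ)] := by
      ext i; fin_cases i <;> simp [hz]
    have hcase : (z 0 = 0 ∧ z 1 = 0 ∧ z 2 = 0 ∧ z 3 = 0 ∧ z 4 = 0) ∨
        (z 0 = 1 ∧ z 1 = 0 ∧ z 2 = 0 ∧ z 3 = 0 ∧ z 4 = 0) ∨
        (z 0 = 0 ∧ z 1 = 1 ∧ z 2 = 0 ∧ z 3 = 0 ∧ z 4 = 0) ∨
        (z 0 = 0 ∧ z 1 = 0 ∧ z 2 = 1 ∧ z 3 = 0 ∧ z 4 = 0) ∨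
        (z 0 = 0 ∧ z 1 = 0 ∧ z 2 = 0 ∧ z 3 = 1 ∧ z 4 = 0) ∨
        (z 0 = 0 ∧ z 1 = 0 ∧ z 2 = 0 ∧ z 3 = 0 ∧ z 4 = 1) := by omega
    rw [simplexVertices_five, hx]
    rcases hcase with h | h | h | h | h | h <;> obtain ⟨e0, e1, e2, e3, e4⟩ := h <;>
      simp [e0, e1, e2, e3, e4]
  · intro hx
    refine ⟨?_, simplexVertices_subset_integerPoints hx⟩
    rw [simplexVertices_five] at hx
    simp only [Set.mem_insert_iff, Set.mem_singleton_iff] at hx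
    rcases hx with rfl | rfl | rfl | rfl | rfl | rfl <;> simp

/-! ### The mixed-integer points of the four-dimensional polyhedron -/

theorem sqrt_two_bounds : 1.414 < √2 ∧ √2 < 1.415 :=
  ⟨Real.lt_sqrt_of_sq_lt (by norm_num), (Real.sqrt_lt' (by norm_num)).2 (by norm_num)⟩

/-- The third inequality after rationalizing its denominators; the two factors `√2 - 1` and
`2 - √2` of the convex combination add up to `1`. -/
theorem mem_polyhedronP_eighth {x : Fin 4 → ℝ} : x ∈ polyhedronP (1 / 8) ↔
    x 3 ≤ x 0 ∧ x 3 ≤ x 2 ∧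
    1 / 8 * x 0 + x 1 + 7 / 8 * ((√2 - 1) * x 2 + (2 - √2) * x 3) ≤ 1 ∧
    0 ≤ x 2 + √2 * x 3 ∧ x 0 - 9 / 8 * x 1 + x 2 - x 3 ≤ 1 := by
  have h2 : √2 * √2 = 2 := Real.mul_self_sqrt (by norm_num)
  have hpos : (1 : ℝ) + √2 ≠ 0 := by positivity
  have e1 : (1 - 1 / 8 : ℝ) / (1 + √2) = 7 / 8 * (√2 - 1) := by
    rw [div_eq_iff hpos]; linear_combination (-7 / 8) * h2
  have e2 : (1 - 1 / 8 : ℝ) * √2 / (1 + √2) = 7 / 8 * (2 - √2) := by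
    rw [div_eq_iff hpos]; linear_combination (7 / 8) * h2
  simp only [polyhedronP, Set.mem_ofPred_eq, ge_iff_le, e1, e2]
  refine and_congr_right fun _ => and_congr_right fun _ =>
    and_congr ?_ (and_congr_right fun _ => ?_)
  · constructor <;> intro h <;> linarith
  · norm_num

/-- The points of `polyhedronP (1 / 8)` with integer coordinates `a, b, c`: the inequalities force
`b ∈ {0, 1}` and leave finitely many values of `c` and `a`. -/
theorem mixed_cases {a b c : ℤ} {t : ℝ} (h1 : t ≤ a) (h2 : t ≤ c)
    (h3 : 1 / 8 * (a : ℝ) + b + 7 / 8 * ((√2 - 1) * c + (2 - √2) * t) ≤ 1)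
    (h4 : 0 ≤ c + √2 * t) (h5 : (a : ℝ) - 9 / 8 * b + c - t ≤ 1) :
    (a = 0 ∧ b = 0 ∧ c = 0 ∧ t = 0) ∨ (a = 1 ∧ b = 0 ∧ c = 0 ∧ t = 0) ∨
    (a = 0 ∧ b = 1 ∧ c = 0 ∧ t = 0) ∨ (a = 0 ∧ b = 0 ∧ c = 1 ∧ t = 0) ∨
    (a = 1 ∧ b = 0 ∧ c = 1 ∧ t = 1) ∨ (a = 0 ∧ b = 1 ∧ c = 1 ∧ √2 * t = -1) := by
  have hs2 : √2 * √2 = 2 := Real.mul_self_sqrt (by norm_num)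
  obtain ⟨hl, hu⟩ := sqrt_two_bounds
  generalize √2 = s at *
  -- the fourth inequality, rewritten as a lower bound on `t`
  have h4' : -(s / 2) * c ≤ t := by nlinarith
  -- the convex combination in the third inequality is nonnegative
  have hw : 0 ≤ (s - 1) * c + (2 - s) * t := by
    have : (s - 1) * c + (2 - s) * t = (s - 1) * (c + s * t) := by
      linear_combination (-t) * hs2
    rw [this]
    exact mul_nonneg (by linarith) h4
  have hc0 : 0 ≤ c := by
    have : (0 : ℝ) ≤ c := by nlinarith
    exact_mod_cast this
  have hb1 : b ≤ 1 := by
    by_contra! hb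
    have hb' : (2 : ℝ) ≤ b := by exact_mod_cast hb
    have hc' : (0 : ℝ) ≤ c := by exact_mod_cast hc0
    have hcb : (c : ℝ) ≤ 1 + 9 / 8 * b := by linarith
    have : (a : ℝ) ≤ 8 - 8 * b := by linarith
    nlinarith
  have hb0 : 0 ≤ b := by
    by_contra! hb
    have hb' : (b : ℝ) ≤ -1 := by exact_mod_cast Int.le_sub_one_of_lt hb
    have hc' : (0 : ℝ) ≤ c := by exact_mod_cast hc0
    linarith
  obtain rfl | rfl : b = 0 ∨ b = 1 := by omega
  · have hc1 : c ≤ 1 := by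
      have : (c : ℝ) ≤ 1 := by push_cast at h5; linarith
      exact_mod_cast this
    have ha1 : a ≤ 1 := by
      have : (a : ℝ) ≤ 1 := by push_cast at h5; linarith
      exact_mod_cast this
    obtain rfl | rfl : c = 0 ∨ c = 1 := by omega
    · push_cast at *
      have ht : t = 0 := by nlinarith
      have ha0 : 0 ≤ a := by
        have : (0 : ℝ) ≤ a := by linarith
        exact_mod_cast this
      obtain rfl | rfl : a = 0 ∨ a = 1 := by omega
      · simp [ht]
      · simp [ht]
    · push_cast at *
      have ht : t = a := by linarith
      have ha0 : 0 ≤ a := by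
        have : (-1 : ℝ) < a := by nlinarith
        have : (-1 : ℤ) < a := by exact_mod_cast this
        omega
      obtain rfl | rfl : a = 0 ∨ a = 1 := by omega
      · simp at ht; simp [ht]
      · simp at ht; simp [ht]
  · push_cast at *
    have hc2 : c ≤ 2 := by
      have : (c : ℝ) < 3 := by linarith
      have : c < 3 := by exact_mod_cast this
      omega
    have ha0 : a ≤ 0 := by
      have : (a : ℝ) ≤ 0 := by linarith
      exact_mod_cast this
    obtain rfl | rfl | rfl : c = 0 ∨ c = 1 ∨ c = 2 := by omega
    · push_cast at *
      have ht : t = 0 := by nlinarith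
      have ha : (0 : ℝ) ≤ a := by linarith
      have : a = 0 := le_antisymm ha0 (by exact_mod_cast ha)
      simp [this, ht]
    · push_cast at *
      have ha : 0 ≤ a := by
        have : (-1 : ℝ) < a := by nlinarith
        have : (-1 : ℤ) < a := by exact_mod_cast this
        omega
      obtain rfl : a = 0 := le_antisymm ha0 ha
      push_cast at *
      have : s * t = -1 := by nlinarith
      simp [this]
    · push_cast at *
      have ha : -1 ≤ a := by
        have : (-2 : ℝ) < a := by nlinarith
        have : (-2 : ℤ) < a := by exact_mod_cast this
        omega
      obtain rfl | rfl : a = 0 ∨ a = -1 := by omega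
      · push_cast at *
        nlinarith
      · push_cast at *
        nlinarith

theorem polyhedronP_inter_mixedIntegerPoints :
    polyhedronP (1 / 8) ∩ mixedIntegerPoints = projPi '' simplexDelta := by
  have hs2 : √2 * √2 = 2 := Real.mul_self_sqrt (by norm_num)
  have hs0 : √2 ≠ 0 := by positivity
  obtain ⟨hl, hu⟩ := sqrt_two_bounds
  have himage : projPi '' simplexDelta = {![0, 0, 0, 0], ![1, 0, 0, 0], ![0, 1, 0, 0],
      ![0, 0, 1, 0], ![1, 0, 1, 1], ![0, 1, 1, -(√2 / 2)]} := by
    have : 1 / √2 = √2 / 2 := by rw [div_eq_div_iff hs0 two_ne_zero]; linarith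
    simp [simplexDelta, Set.image_insert_eq, projPi, ← this]
  rw [himage]
  ext x
  constructor
  · rintro ⟨hx, hz⟩
    choose z hz using hz
    obtain ⟨h1, h2, h3, h4, h5⟩ := mem_polyhedronP_eighth.1 hx
    have z0 : x 0 = z 0 := hz 0
    have z1 : x 1 = z 1 := hz 1
    have z2 : x 2 = z 2 := hz 2
    have hx' : x = ![(z 0 : ℝ), (z 1 : ℝ), (z 2 : ℝ), x 3] := by
      ext i; fin_cases i <;> simp [z0, z1, z2]
    rw [z0] at h1 h3 h5
    rw [z1] at h3 h5
    rw [z2] at h2 h3 h4 h5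
    rw [hx']
    rcases mixed_cases h1 h2 h3 h4 h5 with h | h | h | h | h | h <;>
      obtain ⟨e0, e1, e2, e3⟩ := h
    · simp [e0, e1, e2, e3]
    · simp [e0, e1, e2, e3]
    · simp [e0, e1, e2, e3]
    · simp [e0, e1, e2, e3]
    · simp [e0, e1, e2, e3]
    · have : x 3 = -(√2 / 2) := by
        apply mul_left_cancel₀ hs0
        linarith
      simp [e0, e1, e2, this]
  · intro hx
    simp only [Set.mem_insert_iff, Set.mem_singleton_iff] at hx
    refine ⟨mem_polyhedronP_eighth.2 ?_, ?_⟩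
    · rcases hx with rfl | rfl | rfl | rfl | rfl | rfl <;> simp only [Matrix.cons_val] <;>
        refine ⟨?_, ?_, ?_, ?_, ?_⟩ <;> nlinarith
    · rcases hx with rfl | rfl | rfl | rfl | rfl | rfl <;> intro i <;> fin_cases i <;>
        solve | (refine ⟨0, ?_⟩; simp) | (refine ⟨1, ?_⟩; simp)

/-! ### Lifting along the line -/

theorem pullback_eq_preimage (P : Set (Fin 4 → ℝ)) : pullback P = projPi ⁻¹' P := by
  have hs0 : √2 ≠ 0 := by positivity
  ext x
  simp only [pullback, Set.mem_add, Set.mem_image, SetLike.mem_coe, lineEll,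
    Submodule.mem_span_singleton, Set.mem_preimage]
  constructor
  · rintro ⟨_, ⟨p, hp, rfl⟩, _, ⟨r, rfl⟩, rfl⟩
    convert hp using 1
    ext i
    fin_cases i <;> simp [projPi, mul_comm r, hs0]
  · intro hx
    refine ⟨_, ⟨_, hx, rfl⟩, _, ⟨x 4 / √2, rfl⟩, ?_⟩
    ext i
    fin_cases i <;> simp [projPi, hs0]
    ring

theorem eq_of_sub_div_sqrt_two {a b c d : ℤ}
    (h : (a : ℝ) - 1 / √2 * b = c - 1 / √2 * d) : a = c ∧ b = d := by
  have hs0 : √2 ≠ 0 := by positivity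
  have key : ((a - c : ℤ) : ℝ) * √2 = ((b - d : ℤ) : ℝ) := by
    field_simp at h
    push_cast
    linarith
  have hac : a - c = 0 := by
    by_contra hne
    exact (irrational_sqrt_two.intCast_mul hne) ⟨(b - d : ℤ), by rw [key]; simp⟩
  rw [hac, Int.cast_zero, zero_mul, eq_comm, Int.cast_eq_zero] at key
  omega

theorem simplexDelta_subset_integerPoints : simplexDelta ⊆ integerPoints 5 := by
  rw [← deltaMatrix_image_simplexVertices, ← deltaMatrix_image_integerPoints]
  exact Set.image_mono simplexVertices_subset_integerPoints

/-- The projection along the line is injective on integer points, the slope being irrational. -/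
theorem projPi_injOn_integerPoints : Set.InjOn projPi (integerPoints 5) := by
  intro x hx y hy h
  choose z hz using hx
  choose w hw using hy
  have h0 : x 0 = y 0 := congrFun h 0
  have h1 : x 1 = y 1 := congrFun h 1
  have h2 : x 2 = y 2 := congrFun h 2
  have h3 : x 3 - 1 / √2 * x 4 = y 3 - 1 / √2 * y 4 := congrFun h 3
  rw [hz, hz, hw, hw] at h3
  obtain ⟨e3, e4⟩ := eq_of_sub_div_sqrt_two h3
  ext i
  fin_cases i
  · exact h0
  · exact h1
  · exact h2
  · show x 3 = y 3
    rw [hz, hw, e3]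
  · show x 4 = y 4
    rw [hz, hw, e4]

theorem pullback_inter_integerPoints :
    pullback (polyhedronP (1 / 8)) ∩ integerPoints 5 = simplexDelta := by
  rw [pullback_eq_preimage]
  ext x
  constructor
  · rintro ⟨hx, hz⟩
    have hmix : projPi x ∈ mixedIntegerPoints := fun i => by
      fin_cases i
      · exact hz 0
      · exact hz 1
      · exact hz 2
    have hmem : projPi x ∈ projPi '' simplexDelta :=
      polyhedronP_inter_mixedIntegerPoints ▸ ⟨hx, hmix⟩
    obtain ⟨y, hy, hxy⟩ := hmem
    rwa [← projPi_injOn_integerPoints (simplexDelta_subset_integerPoints hy) hz hxy]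
  · intro hx
    refine ⟨?_, simplexDelta_subset_integerPoints hx⟩
    have : projPi x ∈ polyhedronP (1 / 8) ∩ mixedIntegerPoints :=
      polyhedronP_inter_mixedIntegerPoints ▸ ⟨x, hx, rfl⟩
    exact this.1

/-- `√2` as an element of `ℚ(√2)`. -/
noncomputable def sqrtTwoGen : IntermediateField.adjoin ℚ {√2} :=
  ⟨√2, IntermediateField.mem_adjoin_simple_self ℚ √2⟩

theorem algebraMap_sqrtTwoGen :
    algebraMap (IntermediateField.adjoin ℚ {√2}) ℝ sqrtTwoGen = √2 := rfl

theorem isPolyhedronOver_polyhedronP :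
    IsPolyhedronOver (IntermediateField.adjoin ℚ {√2}) 5 (polyhedronP (1 / 8)) := by
  refine ⟨!![-1, 0, 0, 1; 0, 0, -1, 1;
    1 / 8, 1, 7 / 8 * (sqrtTwoGen - 1), 7 / 8 * (2 - sqrtTwoGen);
    0, 0, -1, -sqrtTwoGen; 1, -(9 / 8), 1, -1], ![0, 0, 1, 0, 1], ?_⟩
  ext x
  rw [mem_polyhedronP_eighth]
  simp only [Set.mem_ofPred_eq, forall_fin_five, Fin.sum_univ_four]
  simp only [Matrix.of_apply, Matrix.cons_val]
  simp only [map_neg, map_one, map_zero, map_mul, map_sub, map_div₀, map_ofNat,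
    algebraMap_sqrtTwoGen]
  refine and_congr ?_ (and_congr ?_ (and_congr ?_ (and_congr ?_ ?_))) <;>
    constructor <;> intro h <;> linarith

theorem isPolyhedronOver_pullback : IsPolyhedronOver (IntermediateField.adjoin ℚ {√2}) 5
    (pullback (polyhedronP (1 / 8))) := by
  have hs2 : √2 * √2 = 2 := Real.mul_self_sqrt (by norm_num)
  have hs0 : √2 ≠ 0 := by positivity
  refine ⟨!![-1, 0, 0, 1, -(sqrtTwoGen / 2); 0, 0, -1, 1, -(sqrtTwoGen / 2);
    1 / 8, 1, 7 / 8 * (sqrtTwoGen - 1), 7 / 8 * (2 - sqrtTwoGen), -(7 / 8) * (sqrtTwoGen - 1);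
    0, 0, -1, -sqrtTwoGen, 1; 1, -(9 / 8), 1, -1, sqrtTwoGen / 2], ![0, 0, 1, 0, 1], ?_⟩
  have hinv : 1 / √2 = √2 / 2 := by rw [div_eq_div_iff hs0 two_ne_zero]; linarith
  ext x
  rw [pullback_eq_preimage, Set.mem_preimage, mem_polyhedronP_eighth]
  simp only [Set.mem_ofPred_eq, forall_fin_five, Fin.sum_univ_five, projPi, hinv]
  simp only [Matrix.of_apply, Matrix.cons_val]
  simp only [map_neg, map_one, map_zero, map_mul, map_sub, map_div₀, map_ofNat,
    algebraMap_sqrtTwoGen]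
  have hx : √2 * √2 * x 4 = 2 * x 4 := by rw [hs2]
  refine and_congr ?_ (and_congr ?_ (and_congr ?_ (and_congr ?_ ?_))) <;>
    constructor <;> intro h <;> linarith

/-! ### The relaxation complexities -/

theorem IsPolyhedronOver.isPolyhedron {K : Type} [Field K] [Algebra K ℝ] {m d : ℕ}
    {P : Set (Fin d → ℝ)} (h : IsPolyhedronOver K m P) : IsPolyhedron P :=
  ⟨m, h.real⟩

theorem isRelaxation_preimage_pullback :
    IsRelaxation (deltaMatrix.mulVec ⁻¹' pullback (polyhedronP (1 / 8))) (simplexVertices 5)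
      (integerPoints 5) := by
  refine ⟨(isPolyhedronOver_pullback.real.preimage_mulVec _).isPolyhedron, ?_⟩
  ext x
  constructor
  · rintro ⟨hx, hz⟩
    have hmem : deltaMatrix.mulVec x ∈ simplexDelta :=
      pullback_inter_integerPoints ▸ ⟨hx, deltaMatrix_mulVec_mem_integerPoints hz⟩
    rw [← deltaMatrix_image_simplexVertices] at hmem
    exact deltaMatrix_mulVec_injective.mem_set_image.1 hmem
  · intro hx
    have hmem : deltaMatrix.mulVec x ∈ simplexDelta :=
      deltaMatrix_image_simplexVertices ▸ Set.mem_image_of_mem _ hx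
    rw [← pullback_inter_integerPoints] at hmem
    exact ⟨hmem.1, simplexVertices_subset_integerPoints hx⟩

theorem rc_simplexVertices_five : rc (simplexVertices 5) = 5 := by
  refine le_antisymm ?_ (le_iInf₂ fun P hP => five_le_encard_facets
    affineIndependent_simplexFamily (hP.2.trans range_simplexFamily.symm) hP.1)
  refine iInf₂_le_of_le _ isRelaxation_preimage_pullback ?_
  exact (isPolyhedronOver_pullback.real.preimage_mulVec _).encard_facets_le
    (vectorSpan_eq_top_of_range affineIndependent_simplexFamily
      (isRelaxation_preimage_pullback.2.trans range_simplexFamily.symm))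

theorem rcRat_simplexVertices_five : rcRat (simplexVertices 5) = 6 := by
  refine le_antisymm ?_ (le_iInf₂ fun P hP => le_iInf fun hrat => six_le_encard_facets
    affineIndependent_simplexFamily (hP.2.trans range_simplexFamily.symm) hrat)
  obtain ⟨P, hP, hX⟩ := exists_rational_relaxation
  refine iInf₂_le_of_le P ⟨hP.isPolyhedron, hX⟩ (iInf_le_of_le ⟨6, hP⟩ ?_)
  exact hP.encard_facets_le (vectorSpan_eq_top_of_range affineIndependent_simplexFamily
    (hX.trans range_simplexFamily.symm))

theorem encard_facets_pullback : (facets (pullback (polyhedronP (1 / 8)))).encard = 5 := by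
  have hX := pullback_inter_integerPoints.trans range_deltaFamily.symm
  exact le_antisymm (isPolyhedronOver_pullback.encard_facets_le
    (vectorSpan_eq_top_of_range affineIndependent_deltaFamily hX))
    (five_le_encard_facets affineIndependent_deltaFamily hX
      isPolyhedronOver_pullback.isPolyhedron)

/-- A rational relaxation would need six facets, but this one has five. -/
theorem not_isRationalPolyhedron_pullback :
    ¬ IsRationalPolyhedron (pullback (polyhedronP (1 / 8))) := fun h => by
  have := six_le_encard_facets affineIndependent_deltaFamily
    (pullback_inter_integerPoints.trans range_deltaFamily.symm) h
  rw [encard_facets_pullback] at this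
  exact absurd this (by norm_num)

end RelaxationComplexity

open RelaxationComplexity
theorem theorem1 :
    -- the relaxation complexity and the rational relaxation complexity of `Δ_5`
    rc (simplexVertices 5) = 5 ∧
    rcRat (simplexVertices 5) = 6 ∧
    -- the explicit irrational relaxation with five facets
    UnimodularlyEquivalent (simplexVertices 5) simplexDelta ∧
    IsPolyhedronOver (IntermediateField.adjoin ℚ {√2}) 5 (polyhedronP (1 / 8)) ∧
    IsRelaxation (polyhedronP (1 / 8)) (projPi '' simplexDelta) mixedIntegerPoints ∧
    pullback (polyhedronP (1 / 8)) = projPi ⁻¹' polyhedronP (1 / 8) ∧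
    IsPolyhedronOver (IntermediateField.adjoin ℚ {√2}) 5 (pullback (polyhedronP (1 / 8))) ∧
    IsRelaxation (pullback (polyhedronP (1 / 8))) simplexDelta (integerPoints 5) ∧
    ¬ IsRationalPolyhedron (pullback (polyhedronP (1 / 8))) ∧
    (facets (pullback (polyhedronP (1 / 8)))).encard = 5 :=
  ⟨rc_simplexVertices_five, rcRat_simplexVertices_five, unimodularlyEquivalent_simplexDelta,
    isPolyhedronOver_polyhedronP,
    ⟨isPolyhedronOver_polyhedronP.isPolyhedron, polyhedronP_inter_mixedIntegerPoints⟩,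
    pullback_eq_preimage _, isPolyhedronOver_pullback,
    ⟨isPolyhedronOver_pullback.isPolyhedron, pullback_inter_integerPoints⟩,
    not_isRationalPolyhedron_pullback, encard_facets_pullback⟩
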